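/- Let $\mathcal H_A\neq\{0\}$ and $\mathcal H_B$ be finite-dimensional complex Hilbert spaces. For positive definite operators $\rho,\sigma$ on the same space, put $\rho\star\sigma=\exp(\log\rho+\log\sigma)$; for positive semidefinite operators that are not both positive definite, put $\rho\star\sigma=\lim_{n\to\infty}\left(\rho^{1/n}\sigma^{1/n}\right)^n$. Operators on different tensor factors are multiplied after embedding them in $\mathcal H_A\otimes\mathcal H_B$ by tensoring with the identity. Let $\operatorname{tr}_B$ denote the partial trace over $\mathcal H_B$ and $\operatorname{tr}_A$ the trace on $\mathcal H_A$. Let $\rho_a$ be a positive definite operator on $\mathcal H_A$, let $\rho_b$ be a positive definite operator on $\mathcal H_A\otimes\mathcal H_B$, and let $\rho_c\neq 0$ be a positive semidefinite operator on $\mathcal H_B$. Then $\operatorname{tr}(\rho_a\star\rho_b\star\rho_c)>0$ and $$ S(\kappa(\rho_a))^{-1}\;\le\;\frac{\operatorname{tr}_A\bigl(\rho_a\star\operatorname{tr}_B(\rho_b\star\rho_c)\bigr)}{\operatorname{tr}(\rho_a\star\rho_b\star\rho_c)}\;\le\; S(\kappa(\rho_a)), $$ where $\rho_a\star\rho_b\star\rho_c=(\rho_a\star\rho_b)\star\rho_c$,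 where $\kappa(\rho_a)=\|\rho_a\|\,\|\rho_a^{-1}\|\ge 1$ is the condition number of $\rho_a$ in the operator norm, and where $S$ is the Specht ratio $$ S(r)=\frac{(r-1)\,r^{1/(r-1)}}{e\,\log r}\quad(r>0,\ r\ne 1),\qquad S(1)=\lim_{r\to1}S(r)=1 . $$ -/

import Mathlib

open scoped ComplexOrder Kronecker

noncomputable section

namespace QFG

/-- The logarithm of a Hermitian (positive definite) matrix, by functional calculus. -/
def matLog {ι : Type*} [Fintype ι] [DecidableEq ι] (ρ : Matrix ι ι ℂ) : Matrix ι ι ℂ :=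
  cfc Real.log ρ

/-- The real power `ρ ^ s` (`s > 0`) of a positive semidefinite matrix, by functional calculus. -/
def matPow {ι : Type*} [Fintype ι] [DecidableEq ι] (ρ : Matrix ι ι ℂ) (s : ℝ) : Matrix ι ι ℂ :=
  cfc (fun x : ℝ => x ^ s) ρ

open Classical in
/-- The star product of two positive semidefinite matrices: `exp (log ρ + log σ)` if both are
positive definite, and `lim (ρ ^ (1/n) * σ ^ (1/n)) ^ n` otherwise. -/
def starProd {ι : Type*} [Fintype ι] [DecidableEq ι] (ρ σ : Matrix ι ι ℂ) : Matrix ι ι ℂ :=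
  if ρ.PosDef ∧ σ.PosDef then
    NormedSpace.exp (matLog ρ + matLog σ)
  else
    Filter.limUnder Filter.atTop
      (fun n : ℕ => (matPow ρ (1 / (n : ℝ)) * matPow σ (1 / (n : ℝ))) ^ n)

/-- An operator on the first tensor factor, embedded as `ρ ⊗ I`. -/
def embedLeft {α : Type*} (β : Type*) [DecidableEq β] (ρ : Matrix α α ℂ) :
    Matrix (α × β) (α × β) ℂ :=
  ρ ⊗ₖ (1 : Matrix β β ℂ)

/-- An operator on the second tensor factor, embedded as `I ⊗ ρ`. -/
def embedRight (α : Type*) {β : Type*} [DecidableEq α] (ρ : Matrix β β ℂ) :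
    Matrix (α × β) (α × β) ℂ :=
  (1 : Matrix α α ℂ) ⊗ₖ ρ

/-- The partial trace over the second tensor factor. -/
def partialTraceRight {α β : Type*} [Fintype β] (M : Matrix (α × β) (α × β) ℂ) : Matrix α α ℂ :=
  Matrix.of fun i j => ∑ k, M (i, k) (j, k)

/-- The condition number `‖ρ‖ * ‖ρ⁻¹‖` of an invertible matrix for the operator norm induced by
the Euclidean norm (for positive definite `ρ`: largest over smallest eigenvalue). -/
def condNumber {ι : Type*} [Fintype ι] [DecidableEq ι] (ρ : Matrix ι ι ℂ) : ℝ :=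
  ‖Matrix.toEuclideanCLM (n := ι) (𝕜 := ℂ) ρ‖ * ‖Matrix.toEuclideanCLM (n := ι) (𝕜 := ℂ) ρ⁻¹‖

/-- The Specht ratio, for `r > 0`. The formula is `0 / 0` at `r = 1`, where the function takes
its limit value `1`. -/
def spechtRatio (r : ℝ) : ℝ :=
  if r = 1 then 1 else (r - 1) * r ^ (1 / (r - 1)) / (Real.exp 1 * Real.log r)

end QFG

end

/-! Put `τ = tr_B(ρb ⋆ ρc)`. Numerator and denominator are both compared with `tr(ρa τ) = tr((ρa ⊗
1)(ρb ⋆ ρc))`. By Golden–Thompson each is at most this quantity; by the reverse inequality with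
constant `S(κ(ρa))`, this quantity is at most `S(κ(ρa))` times each. The two chains give both bounds
on the ratio.

Golden–Thompson comes from the Lie–Trotter limit and a Hölder trace inequality
(`re_trace_mul_pow_le`). The reverse comes from Specht's reverse AM–GM, applied to diagonal entries
in an eigenbasis of the second operator, followed by Peierls (`re_trace_exp_mul_exp_le`).

For singular `ρc`, let `P` be the support projection of `1 ⊗ ρc`. A compressed Trotter limit gives
`ρ ⋆ σ = P exp(P(log ρ + log σ)P)` (`starProd_eq`). As `P` commutes with `ρa ⊗ 1`, both inequalities
pass to the range of `P` by adding `-t(1 - P)` to the exponent and letting `t → ∞`. -/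

open Filter Topology NormedSpace

/-! ### Trotter limits compressed by an idempotent -/

section BanachAlgebra

variable {𝔸 : Type*} [NormedRing 𝔸] [NormedAlgebra ℝ 𝔸] [CompleteSpace 𝔸]

/-- If `n (X n - 1) → L` then `X n ^ n → exp L`. -/
theorem tendsto_pow_exp_of_tendsto_smul_sub_one {X : ℕ → 𝔸} {L : 𝔸}
    (h : Tendsto (fun n : ℕ => (n : ℝ) • (X n - 1)) atTop (𝓝 L)) :
    Tendsto (fun n => X n ^ n) atTop (𝓝 (exp L)) := by
  -- The local inverse `g` of `exp` is a logarithm near `1` with derivative the identity, so `X n ^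
  -- n = exp (n • g (X n))` eventually.
  have hs : HasStrictFDerivAt (exp : 𝔸 → 𝔸) ((ContinuousLinearEquiv.refl ℝ 𝔸 : 𝔸 →L[ℝ] 𝔸)) 0 :=
    hasStrictFDerivAt_exp_zero
  set g := hs.localInverse
  have hg : HasStrictFDerivAt g ((ContinuousLinearEquiv.refl ℝ 𝔸).symm : 𝔸 →L[ℝ] 𝔸) 1 := by
    simpa using hs.to_localInverse
  have hg1 : g 1 = 0 := by
    simpa using hs.localInverse_apply_image
  have hr : ∀ᶠ y in 𝓝 (1 : 𝔸), exp (g y) = y := by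
    simpa using hs.eventually_right_inverse
  have hX : Tendsto X atTop (𝓝 1) := by
    have h0 : Tendsto (fun n : ℕ => (n : ℝ)⁻¹ • ((n : ℝ) • (X n - 1))) atTop (𝓝 ((0 : ℝ) • L)) :=
      tendsto_natCast_atTop_atTop.inv_tendsto_atTop.smul h
    have h1 : Tendsto (fun n : ℕ => X n - 1) atTop (𝓝 0) := by
      rw [zero_smul] at h0
      refine h0.congr' ?_
      filter_upwards [eventually_ne_atTop 0] with n hn
      rw [inv_smul_smul₀ (Nat.cast_ne_zero.mpr hn)]
    simpa using h1.add_const 1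
  have hlim : Tendsto (fun n : ℕ => (n : ℝ) • g (X n)) atTop (𝓝 L) := by
    have h1 : Tendsto (fun n => X n - 1) atTop (𝓝 0) := by simpa using hX.sub_const 1
    have := hg.hasFDerivAt.hasFDerivWithinAt.lim (s := Set.univ) h1 (by simp) h
    simpa [hg1] using this
  let : NormedAlgebra ℚ 𝔸 := .restrictScalars ℚ ℝ 𝔸
  have he : Tendsto (fun n : ℕ => exp ((n : ℝ) • g (X n))) atTop (𝓝 (exp L)) :=
    (exp_continuous.tendsto L).comp hlim
  refine he.congr' ?_
  filter_upwards [hX.eventually hr] with n hn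
  rw [Nat.cast_smul_eq_nsmul, exp_nsmul, hn]

/-- `G * P` does not tend to `1` as `G → 1`, but the base on the right does: the summand `1 - P`
fills in the complement. The power limit thus becomes applicable. -/
theorem mul_pow_eq_mul_compression_pow {R : Type*} [Ring R] {P : R} (hP : P * P = P) (G : R)
    (n : ℕ) : (G * P) ^ (n + 1) = G * P * (P * G * P + (1 - P)) ^ n := by
  have key : G * P * (P * G * P + (1 - P)) = G * P * (G * P) := by
    have h1 : G * P * (P * G * P) = G * (P * P) * (G * P) := by noncomm_ring
    rw [mul_add, h1, hP, mul_sub, mul_one, mul_assoc G P P, hP, sub_self, add_zero]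
  induction n with
  | zero => simp
  | succ n ih =>
    rw [pow_succ (P * G * P + (1 - P)), ← mul_assoc, ← ih, pow_succ _ n, mul_assoc, key,
      ← mul_assoc, ← pow_succ, ← pow_succ]

theorem tendsto_mul_exp_pow_compression {P : 𝔸} (hP : P * P = P) (H K : 𝔸) :
    Tendsto (fun n : ℕ => (exp ((1 / (n : ℝ)) • H) * exp ((1 / (n : ℝ)) • K) * P) ^ n) atTop
      (𝓝 (P * exp (P * (H + K) * P))) := by
  set G : ℝ → 𝔸 := fun t => exp (t • H) * exp (t • K) with hG
  have hG0 : G 0 = 1 := by simp [hG]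
  have hd : HasDerivAt G (H + K) 0 := by
    have h1 : HasDerivAt G _ 0 := (hasDerivAt_exp_smul_const (𝕂 := ℝ) H (0 : ℝ)).mul
      (hasDerivAt_exp_smul_const (𝕂 := ℝ) K (0 : ℝ))
    simpa using h1
  set F : ℝ → 𝔸 := fun t => P * G t * P + (1 - P) with hF
  have hF0 : F 0 = 1 := by simp [hF, hG0, hP]
  have hFd : HasDerivAt F (P * (H + K) * P) 0 :=
    ((hd.const_mul P).mul_const P).add_const (1 - P)
  have hinv : Tendsto (fun n : ℕ => 1 / ((n : ℝ) + 1)) atTop (𝓝 0) :=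
    tendsto_one_div_add_atTop_nhds_zero_nat
  have hlim : Tendsto (fun n : ℕ => ((n : ℝ) + 1) • (F (1 / ((n : ℝ) + 1)) - 1)) atTop
      (𝓝 (P * (H + K) * P)) := by
    have := hFd.hasFDerivAt.lim (1 : ℝ) (l := atTop) (c := fun n : ℕ => (n : ℝ) + 1)
      (tendsto_norm_atTop_atTop.comp
        (tendsto_atTop_add_const_right _ 1 tendsto_natCast_atTop_atTop))
    simpa [hF0] using this
  -- Splitting off one factor `G * P` leaves the power `n` with step `1 / (n + 1)`; the ratio `n /
  -- (n + 1) → 1` absorbs the mismatch.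
  have hlim' : Tendsto (fun n : ℕ => (n : ℝ) • (F (1 / ((n : ℝ) + 1)) - 1)) atTop
      (𝓝 (P * (H + K) * P)) := by
    have h1 := (tendsto_natCast_div_add_atTop (1 : ℝ)).smul hlim
    rw [one_smul] at h1
    refine h1.congr fun n => ?_
    rw [smul_smul, div_mul_cancel₀ _ (by positivity)]
  have hpow := tendsto_pow_exp_of_tendsto_smul_sub_one hlim'
  have hGP : Tendsto (fun n : ℕ => G (1 / ((n : ℝ) + 1)) * P) atTop (𝓝 P) := by
    have := ((hd.continuousAt.tendsto.comp hinv).mul_const P)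
    simpa [hG0] using this
  rw [← tendsto_add_atTop_iff_nat 1]
  refine (hGP.mul hpow).congr fun n => ?_
  rw [← mul_pow_eq_mul_compression_pow hP]
  simp [hG]

end BanachAlgebra

namespace Matrix

variable {ι : Type*} [Fintype ι] [DecidableEq ι]

open scoped Matrix.Norms.L2Operator in
theorem tendsto_mul_exp_pow_compression {P : Matrix ι ι ℂ} (hP : P * P = P)
    (H K : Matrix ι ι ℂ) :
    Tendsto (fun n : ℕ => (exp ((1 / (n : ℝ)) • H) * exp ((1 / (n : ℝ)) • K) * P) ^ n) atTop
      (𝓝 (P * exp (P * (H + K) * P))) :=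
  _root_.tendsto_mul_exp_pow_compression hP H K

/-! ### Trace inequalities -/

omit [DecidableEq ι] in
-- Cauchy–Schwarz for the Hilbert–Schmidt product; with a common bound `c`, entrywise `xy ≤ (x² +
-- y²)/2` is enough.
theorem norm_trace_mul_le_of_sq_le {X Y : Matrix ι ι ℂ} {c : ℝ}
    (hX : (Xᴴ * X).trace.re ≤ c) (hY : (Yᴴ * Y).trace.re ≤ c) : ‖(X * Y).trace‖ ≤ c := by
  have hsq : ∀ Z : Matrix ι ι ℂ, (Zᴴ * Z).trace.re = ∑ i, ∑ j, ‖Z i j‖ ^ 2 := by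
    intro Z
    rw [Finset.sum_comm]
    simp only [trace, diag, mul_apply, conjTranspose_apply, Complex.re_sum]
    refine Finset.sum_congr rfl fun i _ => Finset.sum_congr rfl fun j _ => ?_
    rw [Complex.star_def, ← Complex.normSq_eq_conj_mul_self, Complex.ofReal_re,
      Complex.normSq_eq_norm_sq]
  rw [hsq] at hX hY
  rw [Finset.sum_comm] at hY
  calc ‖(X * Y).trace‖ = ‖∑ i, ∑ j, X i j * Y j i‖ := by simp [trace, mul_apply]
    _ ≤ ∑ i, ∑ j, ‖X i j * Y j i‖ :=
        (norm_sum_le _ _).trans (Finset.sum_le_sum fun i _ => norm_sum_le _ _)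
    _ ≤ ∑ i, ∑ j, (‖X i j‖ ^ 2 + ‖Y j i‖ ^ 2) / 2 := by
        refine Finset.sum_le_sum fun i _ => Finset.sum_le_sum fun j _ => ?_
        rw [norm_mul]
        nlinarith [sq_nonneg (‖X i j‖ - ‖Y j i‖)]
    _ ≤ c := by
        simp only [← Finset.sum_div, Finset.sum_add_distrib]
        linarith

theorem trace_mul_pow_comm (A B : Matrix ι ι ℂ) (n : ℕ) :
    ((A * B) ^ n).trace = ((B * A) ^ n).trace := by
  cases n with
  | zero => simp
  | succ n =>
    have h : A * (B * A) ^ n = (A * B) ^ n * A := by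
      induction n with
      | zero => simp
      | succ n ih => rw [pow_succ, ← mul_assoc, ih, pow_succ]; simp only [mul_assoc]
    rw [pow_succ, ← mul_assoc, ← h, mul_assoc, trace_mul_comm, mul_assoc, ← pow_succ]

end Matrix

theorem List.exists_pairing {M : Type*} [Monoid M] (m : ℕ) (l : List M) (hl : l.length = 2 * m) :
    ∃ l' : List M, l'.length = m ∧ l'.prod = l.prod ∧
      ∀ z ∈ l', ∃ x ∈ l, ∃ y ∈ l, z = x * y := by
  induction m generalizing l with
  | zero => exact ⟨[], rfl, by simp_all, by simp⟩
  | succ m ih =>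
    match l, hl with
    | x :: y :: l, hl =>
      obtain ⟨l', h1, h2, h3⟩ := ih l (by simp at hl; omega)
      refine ⟨x * y :: l', by simp [h1], by simp [h2, mul_assoc], ?_⟩
      intro z hz
      rcases List.mem_cons.mp hz with rfl | hz
      · exact ⟨x, by simp, y, by simp, rfl⟩
      · obtain ⟨a, ha, b, hb, rfl⟩ := h3 z hz
        exact ⟨a, by simp [ha], b, by simp [hb], rfl⟩

theorem List.exists_alternating {M : Type*} [Monoid M] (a b : M) (m : ℕ) :
    ∃ l : List M, l.length = 2 * m ∧ l.prod = (a * b) ^ m ∧ ∀ z ∈ l, z = a ∨ z = b := by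
  induction m with
  | zero => exact ⟨[], by simp⟩
  | succ m ih =>
    obtain ⟨l, h1, h2, h3⟩ := ih
    refine ⟨a :: b :: l, by simp [h1]; omega, by simp [h2, pow_succ', mul_assoc], ?_⟩
    intro z hz
    simp only [List.mem_cons] at hz
    rcases hz with rfl | rfl | hz
    · exact .inl rfl
    · exact .inr rfl
    · exact h3 z hz

namespace Matrix

variable {ι : Type*} [Fintype ι] [DecidableEq ι]

/-- A Hölder inequality for the Schatten norms of exponent a power of two: the trace of a product
of `2 ^ (k + 1)` matrices. -/
theorem norm_trace_list_prod_le {c : ℝ} (k : ℕ) (l : List (Matrix ι ι ℂ))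
    (hl : l.length = 2 ^ (k + 1)) (hc : ∀ X ∈ l, ((Xᴴ * X) ^ 2 ^ k).trace.re ≤ c) :
    ‖l.prod.trace‖ ≤ c := by
  induction k generalizing l with
  | zero =>
    match l, hl with
    | [X, Y], _ =>
      simpa using norm_trace_mul_le_of_sq_le (by simpa using hc X (by simp))
        (by simpa using hc Y (by simp))
  | succ k ih =>
    obtain ⟨l', h1, h2, h3⟩ := l.exists_pairing (2 ^ (k + 1)) (by rw [hl, pow_succ' 2 (k + 1)])
    rw [← h2]
    refine ih l' h1 fun Z hZ => ?_
    obtain ⟨X, hX, Y, hY, rfl⟩ := h3 Z hZ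
    -- By cyclicity the trace for `X * Y` is that of an alternating word in `Xᴴ * X` and `Y * Yᴴ` of
    -- length `2 ^ (k + 1)`, so the induction hypothesis applies a second time.
    obtain ⟨w, hw1, hw2, hw3⟩ := List.exists_alternating (Xᴴ * X) (Y * Yᴴ) (2 ^ k)
    have e : (((X * Y)ᴴ * (X * Y)) ^ 2 ^ k).trace = w.prod.trace := by
      rw [hw2, conjTranspose_mul, mul_assoc, trace_mul_pow_comm]
      simp only [mul_assoc]
    rw [e]
    refine (Complex.re_le_norm _).trans (ih w (by rw [hw1, pow_succ']) fun V hV => ?_)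
    rcases hw3 V hV with rfl | rfl
    · rw [conjTranspose_mul, conjTranspose_conjTranspose, ← pow_two, ← pow_mul, ← pow_succ']
      exact hc X hX
    · rw [conjTranspose_mul, conjTranspose_conjTranspose, ← pow_two, ← pow_mul, ← pow_succ',
        trace_mul_pow_comm]
      exact hc Y hY

theorem re_trace_pow_two_mul_le (X : Matrix ι ι ℂ) (k : ℕ) :
    (X ^ 2 ^ (k + 1)).trace.re ≤ ((Xᴴ * X) ^ 2 ^ k).trace.re := by
  have := norm_trace_list_prod_le (c := ((Xᴴ * X) ^ 2 ^ k).trace.re) k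
    (List.replicate (2 ^ (k + 1)) X) (by simp) (fun Y hY => by rw [List.eq_of_mem_replicate hY])
  rw [List.prod_replicate] at this
  exact (Complex.re_le_norm _).trans this

/-- Lieb–Thirring for powers of two: each round squares `A` and `B` and halves the outer exponent.
-/
theorem re_trace_mul_pow_le {A B : Matrix ι ι ℂ} (hA : A.IsHermitian) (hB : B.IsHermitian)
    (k : ℕ) : ((A * B) ^ 2 ^ k).trace.re ≤ (A ^ 2 ^ k * B ^ 2 ^ k).trace.re := by
  induction k generalizing A B with
  | zero => simp
  | succ k ih =>
    calc ((A * B) ^ 2 ^ (k + 1)).trace.re ≤ (((A * B)ᴴ * (A * B)) ^ 2 ^ k).trace.re :=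
          re_trace_pow_two_mul_le _ _
      _ = ((A ^ 2 * B ^ 2) ^ 2 ^ k).trace.re := by
          rw [conjTranspose_mul, hA.eq, hB.eq, mul_assoc, trace_mul_pow_comm]
          simp only [mul_assoc, pow_two]
      _ ≤ ((A ^ 2) ^ 2 ^ k * (B ^ 2) ^ 2 ^ k).trace.re := ih (hA.pow 2) (hB.pow 2)
      _ = _ := by rw [← pow_mul, ← pow_mul, ← pow_succ']

/-- The Golden–Thompson inequality. -/
theorem re_trace_exp_add_le {A B : Matrix ι ι ℂ} (hA : A.IsHermitian) (hB : B.IsHermitian) :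
    (exp (A + B)).trace.re ≤ (exp A * exp B).trace.re := by
  -- `P = 1` is the plain Lie–Trotter formula; it is used along `n = 2 ^ k`.
  have h1 := tendsto_mul_exp_pow_compression (mul_one (1 : Matrix ι ι ℂ)) A B
  simp only [mul_one, one_mul] at h1
  have h2 := h1.comp (tendsto_pow_atTop_atTop_of_one_lt (one_lt_two (α := ℕ)))
  have hc : Continuous fun M : Matrix ι ι ℂ => M.trace.re :=
    Complex.continuous_re.comp continuous_id.matrix_trace
  refine le_of_tendsto ((hc.tendsto _).comp h2) (Eventually.of_forall fun k => ?_)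
  have hs : ∀ {C : Matrix ι ι ℂ}, C.IsHermitian →
      (exp ((1 / ((2 ^ k : ℕ) : ℝ)) • C)).IsHermitian := fun {C} hC =>
    IsHermitian.exp (hC.smul (IsSelfAdjoint.all _))
  have he : ∀ C : Matrix ι ι ℂ, exp ((1 / ((2 ^ k : ℕ) : ℝ)) • C) ^ 2 ^ k = exp C := by
    intro C
    rw [← exp_nsmul, ← Nat.cast_smul_eq_nsmul ℝ, smul_smul, mul_one_div_cancel (by positivity),
      one_smul]
  have := re_trace_mul_pow_le (hs hA) (hs hB) k
  rwa [he, he] at this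

end Matrix

/-! ### Specht's reverse of AM–GM -/

namespace QFG

theorem spechtRatio_pos {r : ℝ} (hr : 1 ≤ r) : 0 < spechtRatio r := by
  unfold spechtRatio
  split_ifs with h
  · exact one_pos
  · have h1 : 1 < r := lt_of_le_of_ne hr (Ne.symm h)
    have := Real.log_pos h1
    have : 0 < r - 1 := by linarith
    positivity

/-- The function `s ↦ (1 + (r - 1) / log r * s) * exp (-s)` is at most the Specht ratio. -/
theorem one_add_mul_le_spechtRatio_mul_exp {r : ℝ} (hr : 1 < r) (s : ℝ) :
    1 + (r - 1) / Real.log r * s ≤ spechtRatio r * Real.exp s := by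
  have hl := Real.log_pos hr
  have hr1 : 0 < r - 1 := by linarith
  have hα : 0 < (r - 1) / Real.log r := by positivity
  have hS : spechtRatio r * Real.exp s =
      (r - 1) / Real.log r * Real.exp (s + Real.log r / (r - 1) - 1) := by
    rw [spechtRatio, if_neg hr.ne', Real.rpow_def_of_pos (by linarith), Real.exp_sub, Real.exp_add,
      mul_one_div]
    field_simp
  rw [hS]
  -- The tangent bound `u + 1 ≤ exp u`, at the `u` for which `(r - 1) / log r * (u + 1)` is the
  -- left-hand side.
  have h1 := Real.add_one_le_exp (s + Real.log r / (r - 1) - 1)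
  calc 1 + (r - 1) / Real.log r * s
      = (r - 1) / Real.log r * (s + Real.log r / (r - 1) - 1 + 1) := by field_simp; ring
    _ ≤ _ := mul_le_mul_of_nonneg_left h1 hα.le

/-- Specht's reverse of the weighted inequality of arithmetic and geometric means. -/
theorem sum_mul_exp_le_spechtRatio_mul_exp {ι : Type*} [Fintype ι] {p t : ι → ℝ} {m M : ℝ}
    (hp : ∀ j, 0 ≤ p j) (hp1 : ∑ j, p j = 1) (hm : 0 < m)
    (ht : ∀ j, m ≤ Real.exp (t j) ∧ Real.exp (t j) ≤ M) :
    ∑ j, p j * Real.exp (t j) ≤ spechtRatio (M / m) * Real.exp (∑ j, p j * t j) := by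
  have hmM : m ≤ M := by
    have : Nonempty ι := by
      by_contra h
      rw [not_nonempty_iff] at h
      simp at hp1
    obtain ⟨j⟩ := this
    exact (ht j).1.trans (ht j).2
  rcases hmM.eq_or_lt with rfl | hlt
  · have he : ∀ j, Real.exp (t j) = m := fun j => le_antisymm (ht j).2 (ht j).1
    have hl : ∀ j, t j = Real.log m := fun j => by rw [← he j, Real.log_exp]
    simp only [hl, ← Finset.sum_mul, hp1, div_self hm.ne', spechtRatio]
    simp
  · set r := M / m with hr
    have hr1 : 1 < r := (one_lt_div hm).mpr hlt
    have hl := Real.log_pos hr1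
    -- Convexity: after scaling by `m`, `exp` lies below its chord over `[0, log r]`.
    have chord : ∀ j, Real.exp (t j) ≤
        m * (1 + (r - 1) / Real.log r * (t j - Real.log m)) := by
      intro j
      set s := t j - Real.log m with hs
      have hts : Real.exp (t j) = m * Real.exp s := by
        rw [hs, Real.exp_sub, Real.exp_log hm]; field_simp
      have h0 : 0 ≤ s := by
        have := Real.log_le_log hm (ht j).1
        rw [Real.log_exp] at this; linarith
      have h1 : s ≤ Real.log r := by
        have := Real.log_le_log (Real.exp_pos _) (ht j).2
        rw [Real.log_exp] at this
        rw [hr, Real.log_div (by linarith) hm.ne']; linarith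
      have hc := convexOn_exp.2 (Set.mem_univ 0) (Set.mem_univ (Real.log r))
        (sub_nonneg.mpr ((div_le_one hl).mpr h1)) (div_nonneg h0 hl.le) (sub_add_cancel _ _)
      simp only [smul_eq_mul, mul_zero, zero_add, Real.exp_zero, mul_one] at hc
      rw [div_mul_cancel₀ _ hl.ne', Real.exp_log (by linarith)] at hc
      rw [hts]
      refine mul_le_mul_of_nonneg_left (hc.trans_eq ?_) hm.le
      field_simp
      ring
    calc ∑ j, p j * Real.exp (t j)
        ≤ ∑ j, p j * (m * (1 + (r - 1) / Real.log r * (t j - Real.log m))) :=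
          Finset.sum_le_sum fun j _ => mul_le_mul_of_nonneg_left (chord j) (hp j)
      _ = m * ((∑ j, p j) + (r - 1) / Real.log r *
            ((∑ j, p j * t j) - (∑ j, p j) * Real.log m)) := by
          simp only [Finset.sum_mul, ← Finset.sum_sub_distrib, Finset.mul_sum,
            ← Finset.sum_add_distrib]
          exact Finset.sum_congr rfl fun j _ => by ring
      _ ≤ m * (spechtRatio r * Real.exp ((∑ j, p j * t j) - Real.log m)) := by
          rw [hp1, one_mul]
          exact mul_le_mul_of_nonneg_left (one_add_mul_le_spechtRatio_mul_exp hr1 _) hm.le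
      _ = _ := by
          rw [Real.exp_sub, Real.exp_log hm]; field_simp

end QFG

/-! ### Peierls' inequality, its reverse, and reverse Golden–Thompson -/

namespace Matrix

variable {ι : Type*} [Fintype ι] [DecidableEq ι]

open scoped Matrix.Norms.L2Operator in
theorem IsHermitian.exp_eq_cfc {A : Matrix ι ι ℂ} (hA : A.IsHermitian) :
    NormedSpace.exp A = hA.cfc Real.exp := by
  rw [← hA.cfc_eq, CFC.real_exp_eq_normedSpace_exp hA]

theorem IsHermitian.cfc_id_eq {A : Matrix ι ι ℂ} (hA : A.IsHermitian) : hA.cfc id = A := by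
  rw [← hA.cfc_eq, _root_.cfc_id ℝ A hA.isSelfAdjoint]

/-- The weights are squared moduli of overlaps between the column `i` of `U` and an eigenbasis of
`A`. One family serves every `f`, so scalar Jensen and Specht inequalities transfer to diagonal
entries. -/
theorem IsHermitian.exists_weights {A U : Matrix ι ι ℂ} (hA : A.IsHermitian)
    (hU : U ∈ unitaryGroup ι ℂ) (i : ι) :
    ∃ p : ι → ℝ, (∀ j, 0 ≤ p j) ∧ ∑ j, p j = 1 ∧
      ∀ f : ℝ → ℝ, (star U * hA.cfc f * U) i i = ((∑ j, p j * f (hA.eigenvalues j) : ℝ) : ℂ) := by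
  set W : Matrix ι ι ℂ := star U * hA.eigenvectorUnitary with hW
  have key : ∀ f : ℝ → ℝ, (star U * hA.cfc f * U) i i =
      ((∑ j, ‖W i j‖ ^ 2 * f (hA.eigenvalues j) : ℝ) : ℂ) := by
    intro f
    have h1 : star U * hA.cfc f * U =
        W * diagonal (RCLike.ofReal ∘ f ∘ hA.eigenvalues) * star W := by
      rw [IsHermitian.cfc, Unitary.conjStarAlgAut_apply, hW, star_mul, star_star]
      simp only [mul_assoc]
    rw [h1, mul_apply]
    push_cast
    refine Finset.sum_congr rfl fun j _ => ?_
    rw [mul_diagonal, star_apply, Complex.star_def, mul_right_comm, Complex.mul_conj,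
      Complex.normSq_eq_norm_sq]
    simp
  refine ⟨fun j => ‖W i j‖ ^ 2, fun j => by positivity, ?_, key⟩
  have h := key (fun _ => 1)
  have h1 : hA.cfc (fun _ => 1) = 1 := by rw [← hA.cfc_eq, cfc_const_one ℝ A hA.isSelfAdjoint]
  rw [h1, mul_one, mem_unitaryGroup_iff'.mp hU, one_apply_eq] at h
  simp only [mul_one] at h
  exact_mod_cast h.symm

/-- The Peierls inequality for one vector of an orthonormal basis. -/
theorem IsHermitian.exp_re_le_re_exp {A U : Matrix ι ι ℂ} (hA : A.IsHermitian)
    (hU : U ∈ unitaryGroup ι ℂ) (i : ι) :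
    Real.exp ((star U * A * U) i i).re ≤ ((star U * NormedSpace.exp A * U) i i).re := by
  obtain ⟨p, hp, hp1, h⟩ := hA.exists_weights hU i
  have h2 := h id
  rw [hA.cfc_id_eq] at h2
  rw [hA.exp_eq_cfc, h, h2, Complex.ofReal_re, Complex.ofReal_re]
  simpa using convexOn_exp.map_sum_le (t := Finset.univ) (p := hA.eigenvalues)
    (fun j _ => hp j) hp1 (fun j _ => Set.mem_univ _)

theorem IsHermitian.re_exp_le_spechtRatio_mul {A U : Matrix ι ι ℂ} (hA : A.IsHermitian)
    (hU : U ∈ unitaryGroup ι ℂ) {m M : ℝ} (hm : 0 < m)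
    (hs : ∀ x ∈ spectrum ℝ A, m ≤ Real.exp x ∧ Real.exp x ≤ M) (i : ι) :
    ((star U * NormedSpace.exp A * U) i i).re ≤
      QFG.spechtRatio (M / m) * Real.exp ((star U * A * U) i i).re := by
  obtain ⟨p, hp, hp1, h⟩ := hA.exists_weights hU i
  have h2 := h id
  rw [hA.cfc_id_eq] at h2
  rw [hA.exp_eq_cfc, h, h2, Complex.ofReal_re, Complex.ofReal_re]
  exact QFG.sum_mul_exp_le_spechtRatio_mul_exp hp hp1 hm
    fun j => hs _ (hA.eigenvalues_mem_spectrum_real j)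

/-- The reverse Golden–Thompson inequality with the Specht ratio. -/
theorem re_trace_exp_mul_exp_le {A B : Matrix ι ι ℂ} (hA : A.IsHermitian) (hB : B.IsHermitian)
    {m M : ℝ} (hm : 0 < m) (hmM : m ≤ M)
    (hs : ∀ x ∈ spectrum ℝ A, m ≤ Real.exp x ∧ Real.exp x ≤ M) :
    (exp A * exp B).trace.re ≤ QFG.spechtRatio (M / m) * (exp (A + B)).trace.re := by
  -- In an eigenbasis of `B` the trace of `exp A * exp B` involves only diagonal entries of `exp A`.
  -- Reverse Peierls for `A`, then Peierls for `A + B`, finishes.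
  set U : Matrix ι ι ℂ := (hB.eigenvectorUnitary : Matrix ι ι ℂ) with hUdef
  have hU : U ∈ unitaryGroup ι ℂ := hB.eigenvectorUnitary.2
  have hUU : U * star U = 1 := mem_unitaryGroup_iff.mp hU
  have hdiag : ∀ f : ℝ → ℝ, star U * hB.cfc f * U =
      diagonal (fun i => (f (hB.eigenvalues i) : ℂ)) := by
    intro f
    have hUU' : star U * U = 1 := mem_unitaryGroup_iff'.mp hU
    rw [IsHermitian.cfc, Unitary.conjStarAlgAut_apply, ← hUdef]
    rw [show star U * (U * diagonal (RCLike.ofReal ∘ f ∘ hB.eigenvalues) * star U) * U =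
      (star U * U) * diagonal (RCLike.ofReal ∘ f ∘ hB.eigenvalues) * (star U * U) by
        simp only [mul_assoc], hUU']
    simp [Function.comp_def]
  have htr : ∀ N : Matrix ι ι ℂ, N.trace.re = ∑ i, ((star U * N * U) i i).re := by
    intro N
    have : N.trace = (star U * N * U).trace := by
      rw [trace_mul_comm, ← mul_assoc, hUU, one_mul]
    rw [this]
    simp [trace]
  have hBU := hdiag id
  rw [hB.cfc_id_eq] at hBU
  have hadd : ∀ i, ((star U * (A + B) * U) i i).re =
      ((star U * A * U) i i).re + hB.eigenvalues i := by
    intro i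
    rw [mul_add, add_mul, add_apply, hBU]
    simp
  have hmul : ∀ i, ((star U * (exp A * exp B) * U) i i).re =
      ((star U * exp A * U) i i).re * Real.exp (hB.eigenvalues i) := by
    intro i
    rw [show star U * (exp A * exp B) * U = star U * exp A * U * (star U * exp B * U) by
      calc star U * (exp A * exp B) * U = star U * exp A * (U * star U) * exp B * U := by
            rw [hUU]; simp only [mul_assoc, mul_one]
        _ = _ := by simp only [mul_assoc], hB.exp_eq_cfc, hdiag, mul_diagonal]
    rw [Complex.re_mul_ofReal]
  rw [htr, htr, Finset.mul_sum]
  refine Finset.sum_le_sum fun i _ => ?_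
  rw [hmul]
  have hS : 0 < QFG.spechtRatio (M / m) := QFG.spechtRatio_pos ((one_le_div hm).mpr hmM)
  calc _ ≤ QFG.spechtRatio (M / m) * Real.exp ((star U * A * U) i i).re *
        Real.exp (hB.eigenvalues i) :=
        mul_le_mul_of_nonneg_right (hA.re_exp_le_spechtRatio_mul hU hm hs i) (Real.exp_pos _).le
    _ = QFG.spechtRatio (M / m) * Real.exp ((star U * (A + B) * U) i i).re := by
        rw [hadd, Real.exp_add, mul_assoc]
    _ ≤ _ := mul_le_mul_of_nonneg_left ((hA.add hB).exp_re_le_re_exp hU i) hS.le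

/-- A finite spectrum admits discontinuous functions in the calculus, such as the indicator defining
a support projection. -/
theorem continuousOn_real_spectrum (A : Matrix ι ι ℂ) (f : ℝ → ℝ) :
    ContinuousOn f (spectrum ℝ A) :=
  A.finite_real_spectrum.continuousOn f

open scoped Matrix.Norms.L2Operator in
theorem mul_exp_of_mul_eq {Q A B : Matrix ι ι ℂ} (h : Q * A = B * Q) : Q * exp A = exp B * Q := by
  let : NormedAlgebra ℚ (Matrix ι ι ℂ) := .restrictScalars ℚ ℝ _
  exact SemiconjBy.exp_right (x := Q) h

open scoped Matrix.Norms.L2Operator MatrixOrder in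
theorem IsHermitian.posDef_exp {A : Matrix ι ι ℂ} (hA : A.IsHermitian) : (NormedSpace.exp A).PosDef := by
  have h : (NormedSpace.exp A).PosSemidef :=
    nonneg_iff_posSemidef.mp (IsSelfAdjoint.exp_nonneg hA.isSelfAdjoint)
  exact h.posDef_iff_isUnit.mpr (isUnit_exp A)

theorem isHermitian_cfc (f : ℝ → ℝ) (A : Matrix ι ι ℂ) : (cfc f A).IsHermitian :=
  cfc_predicate f A

open scoped Matrix.Norms.L2Operator in
theorem IsHermitian.exp_cfc {A : Matrix ι ι ℂ} (hA : A.IsHermitian) (f : ℝ → ℝ) :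
    NormedSpace.exp (cfc f A) = cfc (fun x => Real.exp (f x)) A := by
  rw [← CFC.real_exp_eq_normedSpace_exp (cfc_predicate f A),
    cfc_comp' Real.exp f A Real.continuous_exp.continuousOn (continuousOn_real_spectrum A f)
      hA.isSelfAdjoint]

theorem PosDef.pos_of_mem_spectrum {A : Matrix ι ι ℂ} (hA : A.PosDef) {x : ℝ}
    (hx : x ∈ spectrum ℝ A) : 0 < x := by
  rw [hA.isHermitian.spectrum_real_eq_range_eigenvalues] at hx
  obtain ⟨i, rfl⟩ := hx
  exact hA.eigenvalues_pos i

theorem PosSemidef.nonneg_of_mem_spectrum {A : Matrix ι ι ℂ} (hA : A.PosSemidef) {x : ℝ}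
    (hx : x ∈ spectrum ℝ A) : 0 ≤ x := by
  rw [hA.isHermitian.spectrum_real_eq_range_eigenvalues] at hx
  obtain ⟨i, rfl⟩ := hx
  exact hA.eigenvalues_nonneg i

end Matrix

/-! ### The star product with a semidefinite factor -/

namespace QFG

open Matrix

variable {ι : Type*} [Fintype ι] [DecidableEq ι]

/-- The projection onto the range of a Hermitian matrix. -/
noncomputable def suppProj (σ : Matrix ι ι ℂ) : Matrix ι ι ℂ :=
  cfc (fun x : ℝ => if x = 0 then 0 else 1) σ

theorem isHermitian_suppProj (σ : Matrix ι ι ℂ) : (suppProj σ).IsHermitian :=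
  isHermitian_cfc _ σ

theorem isHermitian_matLog (σ : Matrix ι ι ℂ) : (matLog σ).IsHermitian :=
  isHermitian_cfc _ σ

theorem suppProj_mul_self (σ : Matrix ι ι ℂ) : suppProj σ * suppProj σ = suppProj σ := by
  rw [suppProj, ← cfc_mul _ _ σ (continuousOn_real_spectrum _ _) (continuousOn_real_spectrum _ _)]
  congr 1
  ext x
  split_ifs <;> simp

theorem mul_suppProj {σ : Matrix ι ι ℂ} (hσ : σ.IsHermitian) : σ * suppProj σ = σ := by
  have h : σ = cfc (id : ℝ → ℝ) σ := (cfc_id ℝ σ hσ.isSelfAdjoint).symm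
  conv_lhs => enter [1]; rw [h]
  conv_rhs => rw [h]
  rw [suppProj, ← cfc_mul _ _ σ (continuousOn_real_spectrum _ _) (continuousOn_real_spectrum _ _)]
  congr 1
  ext x
  split_ifs with hx <;> simp [hx]

theorem suppProj_of_posDef {σ : Matrix ι ι ℂ} (hσ : σ.PosDef) : suppProj σ = 1 := by
  rw [← cfc_const_one ℝ σ hσ.isHermitian.isSelfAdjoint, suppProj]
  exact cfc_congr fun x hx => if_neg (hσ.pos_of_mem_spectrum hx).ne'

theorem commute_suppProj {σ A : Matrix ι ι ℂ} (h : Commute σ A) : Commute (suppProj σ) A :=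
  h.cfc_real _

/-- Since `Real.log 0 = 0`, the exponential is `1` on the kernel of `σ`; the projection restores the
value `0 ^ s = 0`, which needs `s ≠ 0`. -/
theorem matPow_eq {σ : Matrix ι ι ℂ} (hσ : σ.PosSemidef) {s : ℝ} (hs : s ≠ 0) :
    matPow σ s = exp (s • matLog σ) * suppProj σ := by
  have h1 : s • matLog σ = cfc (fun x => s * Real.log x) σ :=
    (cfc_const_mul s Real.log σ (continuousOn_real_spectrum _ _)).symm
  rw [h1, hσ.isHermitian.exp_cfc, suppProj,
    ← cfc_mul _ _ σ (continuousOn_real_spectrum _ _) (continuousOn_real_spectrum _ _), matPow]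
  refine cfc_congr fun x hx => ?_
  rcases (hσ.nonneg_of_mem_spectrum hx).eq_or_lt with rfl | h0
  · simp [Real.zero_rpow hs]
  · simp [h0.ne', Real.rpow_def_of_pos h0, mul_comm]

theorem matLog_exp {A : Matrix ι ι ℂ} (hA : A.IsHermitian) : matLog (exp A) = A := by
  open scoped Matrix.Norms.L2Operator in
  exact CFC.log_exp A hA.isSelfAdjoint

theorem exp_matLog {ρ : Matrix ι ι ℂ} (hρ : ρ.PosDef) : exp (matLog ρ) = ρ := by
  open scoped Matrix.Norms.L2Operator MatrixOrder in
  exact CFC.exp_log ρ hρ.isStrictlyPositive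

/-- The star product of a positive definite and a positive semidefinite matrix. -/
theorem starProd_eq {ρ σ : Matrix ι ι ℂ} (hρ : ρ.PosDef) (hσ : σ.PosSemidef) :
    starProd ρ σ = suppProj σ * exp (suppProj σ * (matLog ρ + matLog σ) * suppProj σ) := by
  unfold starProd
  split_ifs with h
  · simp [suppProj_of_posDef h.2]
  · refine Tendsto.limUnder_eq ?_
    refine (tendsto_mul_exp_pow_compression (suppProj_mul_self σ) (matLog ρ)
      (matLog σ)).congr' ?_
    filter_upwards [eventually_ne_atTop 0] with n hn
    have hn' : 1 / (n : ℝ) ≠ 0 := one_div_ne_zero (Nat.cast_ne_zero.mpr hn)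
    rw [matPow_eq hρ.posSemidef hn', matPow_eq hσ hn', suppProj_of_posDef hρ, mul_one, mul_assoc]

theorem starProd_of_posDef {ρ σ : Matrix ι ι ℂ} (hρ : ρ.PosDef) (hσ : σ.PosDef) :
    starProd ρ σ = exp (matLog ρ + matLog σ) :=
  if_pos ⟨hρ, hσ⟩

end QFG

/-! ### Golden–Thompson on the range of a projection -/

namespace Matrix

variable {ι : Type*} [Fintype ι] [DecidableEq ι]

theorem exp_smul_one_sub_of_idem {P : Matrix ι ι ℂ} (hP : P * P = P) (t : ℝ) :
    exp (t • (1 - P)) = P + Real.exp t • (1 - P) := by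
  have hQ : (1 - P) * (1 - P) = 1 - P := by simp [mul_sub, sub_mul, hP]
  have hPQ : P * (1 - P) = 0 := by rw [mul_sub, hP]; simp
  have h1 : P * exp (t • (1 - P)) = P := by
    have := mul_exp_of_mul_eq (Q := P) (A := t • (1 - P)) (B := 0) (by simp [hPQ])
    simpa using this
  have h2 : (1 - P) * exp (t • (1 - P)) = Real.exp t • (1 - P) := by
    have h := mul_exp_of_mul_eq (Q := 1 - P) (A := t • (1 - P)) (B := diagonal fun _ => (t : ℂ))
      (by rw [mul_smul_comm, hQ]; ext i j; simp)
    rw [h, exp_diagonal]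
    ext i j
    rw [diagonal_mul, Pi.coe_exp, ← Complex.exp_eq_exp_ℂ, ← Complex.ofReal_exp]
    simp
  calc exp (t • (1 - P)) = P * exp (t • (1 - P)) + (1 - P) * exp (t • (1 - P)) := by
        rw [← add_mul]; simp
    _ = _ := by rw [h1, h2]

theorem tendsto_re_trace_mul_exp_smul_one_sub {P : Matrix ι ι ℂ} (hP : P * P = P)
    (M : Matrix ι ι ℂ) :
    Tendsto (fun t : ℝ => (M * exp ((-t) • (1 - P))).trace.re) atTop (𝓝 (M * P).trace.re) := by
  have h : ∀ t : ℝ, (M * exp ((-t) • (1 - P))).trace.re =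
      (M * P).trace.re + Real.exp (-t) * (M * (1 - P)).trace.re := by
    intro t
    rw [exp_smul_one_sub_of_idem hP, mul_add, trace_add, mul_smul_comm, trace_smul, Complex.add_re, Complex.smul_re,
      smul_eq_mul]
  simp only [h]
  simpa using (Real.tendsto_exp_neg_atTop_nhds_zero.mul_const
    (M * (1 - P)).trace.re).const_add (M * P).trace.re

section Compression

variable {P H Z : Matrix ι ι ℂ}

/-- `P` intertwines the two exponents: `P * (P * H * P + Z) = (H + Z) * P`. -/
theorem mul_exp_compression_add (hP : P * P = P) (hPH : Commute P H) (hPZ : Commute P Z) :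
    P * exp (P * H * P + Z) = exp (H + Z) * P := by
  refine mul_exp_of_mul_eq ?_
  rw [mul_add, add_mul, hPZ.eq, mul_assoc P H P, ← hPH.eq, ← mul_assoc P P H, hP, ← mul_assoc,
    hP, hPH.eq]

theorem exp_add_smul_one_sub (hPH : Commute P H) (t : ℝ) :
    exp (H + t • (1 - P)) = exp H * exp (t • (1 - P)) :=
  exp_add_of_commute _ _ (((Commute.one_left H).sub_left hPH).symm.smul_right t)

omit [Fintype ι] in
theorem IsHermitian.add_smul_one_sub (hP : P.IsHermitian) (hZ : Z.IsHermitian) (t : ℝ) :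
    (Z + t • (1 - P)).IsHermitian :=
  hZ.add ((isHermitian_one.sub hP).smul (IsSelfAdjoint.all _))

/-- The Golden–Thompson inequality on the range of a projection. -/
theorem re_trace_exp_compression_le (hP : P * P = P) (hPh : P.IsHermitian) (hH : H.IsHermitian)
    (hZ : Z.IsHermitian) (hPH : Commute P H) (hPZ : Commute P Z) :
    (P * exp (P * H * P + Z)).trace.re ≤ (exp H * (P * exp Z)).trace.re := by
  rw [mul_exp_compression_add hP hPH hPZ, mul_exp_of_mul_eq hPZ.eq, ← mul_assoc]
  refine le_of_tendsto_of_tendsto' (tendsto_re_trace_mul_exp_smul_one_sub hP _)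
    (tendsto_re_trace_mul_exp_smul_one_sub hP _) fun t => ?_
  have := re_trace_exp_add_le hH (hPh.add_smul_one_sub hZ (-t))
  rwa [← add_assoc, exp_add_smul_one_sub (hPH.add_right hPZ), exp_add_smul_one_sub hPZ,
    ← mul_assoc] at this

/-- The reverse Golden–Thompson inequality on the range of a projection. -/
theorem re_trace_exp_mul_exp_compression_le (hP : P * P = P) (hPh : P.IsHermitian)
    (hH : H.IsHermitian) (hZ : Z.IsHermitian) (hPH : Commute P H) (hPZ : Commute P Z)
    {m M : ℝ} (hm : 0 < m) (hmM : m ≤ M)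
    (hs : ∀ x ∈ spectrum ℝ H, m ≤ Real.exp x ∧ Real.exp x ≤ M) :
    (exp H * (P * exp Z)).trace.re ≤
      QFG.spechtRatio (M / m) * (P * exp (P * H * P + Z)).trace.re := by
  rw [mul_exp_compression_add hP hPH hPZ, mul_exp_of_mul_eq hPZ.eq, ← mul_assoc]
  -- The Specht constant depends only on the spectrum of `H`, so it is uniform in the penalty `t`.
  refine le_of_tendsto_of_tendsto' (tendsto_re_trace_mul_exp_smul_one_sub hP _)
    ((tendsto_re_trace_mul_exp_smul_one_sub hP _).const_mul _) fun t => ?_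
  have := re_trace_exp_mul_exp_le hH (hPh.add_smul_one_sub hZ (-t)) hm hmM hs
  rwa [← add_assoc, exp_add_smul_one_sub (hPH.add_right hPZ), exp_add_smul_one_sub hPZ,
    ← mul_assoc] at this

end Compression

omit [DecidableEq ι] in
theorem IsHermitian.trace_eq_ofReal_re {A : Matrix ι ι ℂ} (hA : A.IsHermitian) :
    A.trace = (A.trace.re : ℂ) := by
  have h : star A.trace = A.trace := by rw [← trace_conjTranspose, hA.eq]
  exact (Complex.conj_eq_iff_re.mp h).symm

end Matrix

/-! ### Tensor embeddings and the partial trace -/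

namespace QFG

open Matrix

variable {α β : Type*} [Fintype α] [DecidableEq α] [Fintype β] [DecidableEq β]

omit [DecidableEq α] in
theorem posDef_embedLeft {ρ : Matrix α α ℂ} (hρ : ρ.PosDef) : (embedLeft β ρ).PosDef :=
  hρ.kronecker PosDef.one

omit [DecidableEq β] in
theorem posSemidef_embedRight {ρ : Matrix β β ℂ} (hρ : ρ.PosSemidef) :
    (embedRight α ρ).PosSemidef :=
  PosSemidef.one.kronecker hρ

theorem commute_embed (ρ : Matrix α α ℂ) (σ : Matrix β β ℂ) :
    Commute (embedRight α σ) (embedLeft β ρ) := by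
  simp [Commute, SemiconjBy, embedLeft, embedRight, ← mul_kronecker_mul]

/-- An inverse of `x - ρ` tensored with `1` inverts `x - ρ ⊗ 1`. Equality would fail for empty `β`.
-/
theorem spectrum_embedLeft_subset (ρ : Matrix α α ℂ) :
    spectrum ℝ (embedLeft β ρ) ⊆ spectrum ℝ ρ := by
  intro x hx hu
  refine hx ?_
  have h : algebraMap ℝ (Matrix (α × β) (α × β) ℂ) x - embedLeft β ρ =
      (algebraMap ℝ (Matrix α α ℂ) x - ρ) ⊗ₖ (1 : Matrix β β ℂ) := by
    rw [sub_eq_add_neg _ ρ, add_kronecker, ← neg_one_smul ℂ ρ, smul_kronecker,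
      Algebra.algebraMap_eq_smul_one, Algebra.algebraMap_eq_smul_one, smul_kronecker,
      one_kronecker_one, embedLeft, neg_one_smul, ← sub_eq_add_neg]
  rw [spectrum.mem_resolventSet_iff, h]
  obtain ⟨u, hu⟩ := hu
  rw [← hu]
  refine IsUnit.of_mul_eq_one (((u⁻¹ : (Matrix α α ℂ)ˣ) : Matrix α α ℂ) ⊗ₖ (1 : Matrix β β ℂ)) ?_
  rw [← mul_kronecker_mul]
  simp

omit [DecidableEq α] in
theorem trace_mul_partialTraceRight (ρ : Matrix α α ℂ) (Y : Matrix (α × β) (α × β) ℂ) :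
    (ρ * partialTraceRight Y).trace = (embedLeft β ρ * Y).trace := by
  simp only [trace, diag, mul_apply, partialTraceRight, of_apply, embedLeft, kroneckerMap_apply,
    Fintype.sum_prod_type, one_apply, mul_ite, mul_one, mul_zero, ite_mul, zero_mul,
    Finset.sum_ite_eq, Finset.mem_univ, if_true, Finset.mul_sum]
  exact Finset.sum_congr rfl fun i _ => Finset.sum_comm

omit [DecidableEq α] in
theorem dotProduct_partialTraceRight_mulVec (Y : Matrix (α × β) (α × β) ℂ) (v : α → ℂ) :
    star v ⬝ᵥ (partialTraceRight Y *ᵥ v) =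
      ∑ k : β, star (fun x : α × β => if x.2 = k then v x.1 else 0) ⬝ᵥ
        (Y *ᵥ fun x : α × β => if x.2 = k then v x.1 else 0) := by
  simp only [dotProduct, mulVec, partialTraceRight, of_apply, Fintype.sum_prod_type, Pi.star_apply,
    mul_ite, mul_zero, apply_ite (star : ℂ → ℂ), star_zero, ite_mul, zero_mul,
    Finset.sum_ite_eq', Finset.mem_univ, if_true, Finset.sum_mul, Finset.mul_sum]
  conv_rhs => rw [Finset.sum_comm]
  refine Finset.sum_congr rfl fun i _ => ?_
  rw [Finset.sum_comm]
  refine Finset.sum_congr rfl fun k _ => ?_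
  conv_rhs => rw [Finset.sum_comm]
  exact Finset.sum_congr rfl fun j _ => by simp

omit [Fintype α] [DecidableEq α] [DecidableEq β] in
theorem isHermitian_partialTraceRight {Y : Matrix (α × β) (α × β) ℂ} (hY : Y.IsHermitian) :
    (partialTraceRight Y).IsHermitian := by
  ext i j
  simp only [conjTranspose_apply, partialTraceRight, of_apply, star_sum]
  exact Finset.sum_congr rfl fun k _ => hY.apply _ _

/-- If `P` is Hermitian and `σ P = σ` for some nonzero `σ = 1 ⊗ ρ`, then the partial trace of
`P E P` is positive definite for every positive definite `E`. -/
theorem posDef_partialTraceRight {ρ : Matrix β β ℂ} (hρ : ρ ≠ 0) {P E : Matrix (α × β) (α × β) ℂ}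
    (hP : P.IsHermitian) (hσ : embedRight α ρ * P = embedRight α ρ) (hE : E.PosDef) :
    (partialTraceRight (P * E * P)).PosDef := by
  have hH : (P * E * P).IsHermitian := by
    have := isHermitian_conjTranspose_mul_mul P hE.isHermitian
    rwa [hP.eq] at this
  refine PosDef.of_dotProduct_mulVec_pos (isHermitian_partialTraceRight hH) fun v hv => ?_
  rw [dotProduct_partialTraceRight_mulVec]
  set w : β → α × β → ℂ := fun k x => if x.2 = k then v x.1 else 0 with hw
  have hquad : ∀ k, star (w k) ⬝ᵥ ((P * E * P) *ᵥ w k) =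
      star (P *ᵥ w k) ⬝ᵥ (E *ᵥ (P *ᵥ w k)) := by
    intro k
    rw [star_mulVec, ← dotProduct_mulVec, hP.eq, mulVec_mulVec, mulVec_mulVec, mul_assoc]
  -- If `P` killed every `v ⊗ e_k`, so would `1 ⊗ ρ = (1 ⊗ ρ) P`, forcing `ρ = 0`.
  obtain ⟨k, hk⟩ : ∃ k, P *ᵥ w k ≠ 0 := by
    by_contra! h
    refine hρ ?_
    obtain ⟨i, hi⟩ := Function.ne_iff.mp hv
    ext l k
    have h1 : (embedRight α ρ *ᵥ w k) (i, l) = 0 := by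
      rw [← hσ, ← mulVec_mulVec, h k, mulVec_zero, Pi.zero_apply]
    have h2 : (embedRight α ρ *ᵥ w k) (i, l) = ρ l k * v i := by
      simp [hw, mulVec, dotProduct, embedRight, Fintype.sum_prod_type, one_apply]
    exact (mul_eq_zero.mp (h2.symm.trans h1)).resolve_right hi
  refine Finset.sum_pos' (fun k _ => ?_) ⟨k, Finset.mem_univ k, ?_⟩
  · exact (hquad k).symm ▸ hE.posSemidef.dotProduct_mulVec_nonneg _
  · exact (hquad k).symm ▸ hE.dotProduct_mulVec_pos hk

/-! ### Spectral bounds from the condition number -/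

section CondNumber

variable {ι : Type*} [Fintype ι] [DecidableEq ι]

theorem exists_spectrum_bounds [Nonempty ι] {ρ : Matrix ι ι ℂ} (hρ : ρ.PosDef) :
    ∃ m M : ℝ, 0 < m ∧ m ≤ M ∧ condNumber ρ = M / m ∧ ∀ x ∈ spectrum ℝ ρ, m ≤ x ∧ x ≤ M := by
  open scoped Matrix.Norms.L2Operator in
  have hcond : condNumber ρ = ‖ρ‖ * ‖ρ⁻¹‖ := rfl
  have hu : ρ * ρ⁻¹ = 1 := mul_nonsing_inv _ ((isUnit_iff_isUnit_det _).mp hρ.isUnit)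
  have hle : ∀ {A : Matrix ι ι ℂ} {x : ℝ}, x ∈ spectrum ℝ A → x ≤ ‖A‖ := fun hx =>
    (le_abs_self _).trans (spectrum.norm_le_norm_of_mem hx)
  have hinv : 0 < ‖ρ⁻¹‖ := by
    rw [norm_pos_iff]
    intro h
    rw [h, mul_zero] at hu
    exact zero_ne_one hu
  have hb : ∀ x ∈ spectrum ℝ ρ, ‖ρ⁻¹‖⁻¹ ≤ x ∧ x ≤ ‖ρ‖ := by
    intro x hx
    have hx0 := hρ.pos_of_mem_spectrum hx
    refine ⟨?_, hle hx⟩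
    have h := (spectrum.inv_mem_iff (R := ℝ) (r := Units.mk0 x hx0.ne')
      (a := hρ.isUnit.unit)).mp hx
    rw [coe_units_inv] at h
    exact inv_le_of_inv_le₀ hx0 (hle h)
  refine ⟨‖ρ⁻¹‖⁻¹, ‖ρ‖, inv_pos.mpr hinv, ?_, by rw [hcond, div_inv_eq_mul], hb⟩
  have hmem := hρ.isHermitian.eigenvalues_mem_spectrum_real (Classical.arbitrary ι)
  exact (hb _ hmem).1.trans (hb _ hmem).2

theorem exp_bounds_of_mem_spectrum_matLog {ρ : Matrix ι ι ℂ} (hρ : ρ.PosDef) {m M : ℝ}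
    (h : ∀ x ∈ spectrum ℝ ρ, m ≤ x ∧ x ≤ M) :
    ∀ x ∈ spectrum ℝ (matLog ρ), m ≤ Real.exp x ∧ Real.exp x ≤ M := by
  intro x hx
  rw [matLog, cfc_map_spectrum Real.log ρ hρ.isHermitian.isSelfAdjoint
    (continuousOn_real_spectrum _ _)] at hx
  obtain ⟨y, hy, rfl⟩ := hx
  rw [Real.exp_log (hρ.pos_of_mem_spectrum hy)]
  exact h y hy

end CondNumber

end QFG

/-! ### Assembly of the two-sided bound -/

theorem mainTheorem6 {α β : Type*} [Fintype α] [DecidableEq α] [Nonempty α]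
    [Fintype β] [DecidableEq β]
    (ρa : Matrix α α ℂ) (ρb : Matrix (α × β) (α × β) ℂ) (ρc : Matrix β β ℂ)
    (ha : ρa.PosDef) (hb : ρb.PosDef) (hc : ρc.PosSemidef) (hc0 : ρc ≠ 0) :
    let num : ℂ := (QFG.starProd ρa
      (QFG.partialTraceRight (QFG.starProd ρb (QFG.embedRight α ρc)))).trace
    let den : ℂ := (QFG.starProd (QFG.starProd (QFG.embedLeft β ρa) ρb)
      (QFG.embedRight α ρc)).trace
    1 ≤ QFG.condNumber ρa ∧ 0 < den ∧
      (((QFG.spechtRatio (QFG.condNumber ρa))⁻¹ : ℝ) : ℂ) ≤ num / den ∧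
      num / den ≤ ((QFG.spechtRatio (QFG.condNumber ρa) : ℝ) : ℂ) := by
  intro num den
  open QFG Matrix in
  obtain ⟨m, M, hm, hmM, hκ, hspec⟩ := exists_spectrum_bounds ha
  have hκ1 : 1 ≤ condNumber ρa := by rw [hκ]; exact (one_le_div hm).mpr hmM
  have hS := spechtRatio_pos hκ1
  have hX : (embedLeft β ρa).PosDef := posDef_embedLeft ha
  set σ := embedRight α ρc with hσdef
  have hσ : σ.PosSemidef := posSemidef_embedRight hc
  set P := suppProj σ with hPdef
  have hP : P * P = P := suppProj_mul_self σ
  have hPh : P.IsHermitian := isHermitian_suppProj σ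
  set H := matLog (embedLeft β ρa) with hHdef
  have hH : H.IsHermitian := isHermitian_matLog _
  have hexpH : exp H = embedLeft β ρa := exp_matLog hX
  have hPH : Commute P H :=
    ((commute_suppProj (commute_embed ρa ρc)).symm.cfc_real Real.log).symm
  set L := matLog ρb + matLog σ with hLdef
  have hL : L.IsHermitian := (isHermitian_matLog _).add (isHermitian_matLog _)
  set Z := P * L * P with hZdef
  have hZ : Z.IsHermitian := by
    have := isHermitian_conjTranspose_mul_mul P hL
    rwa [hPh.eq] at this
  have hPZ : Commute P Z := by
    rw [Commute, SemiconjBy, hZdef, mul_assoc (P * L), hP, ← mul_assoc, ← mul_assoc, hP]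
  have hY : starProd ρb σ = P * exp Z := starProd_eq hb hσ
  -- `ρa ⋆ ρb` is positive definite with logarithm `H + matLog ρb`, so the outer star product has
  -- exponent `P * (H + L) * P = P * H * P + Z`.
  have hden : den = (P * exp (P * H * P + Z)).trace := by
    have h1 : starProd (embedLeft β ρa) ρb = exp (H + matLog ρb) := starProd_of_posDef hX hb
    have hHb : (H + matLog ρb).IsHermitian := hH.add (isHermitian_matLog _)
    have h2 : den = (starProd (exp (H + matLog ρb)) σ).trace := by rw [← h1]
    rw [h2, starProd_eq hHb.posDef_exp hσ, matLog_exp hHb, add_assoc, mul_add, add_mul]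
  set τ := partialTraceRight (starProd ρb σ) with hτdef
  have hτ : τ.PosDef := by
    have h1 : P * exp Z = P * exp Z * P := by
      rw [mul_assoc, ← mul_exp_of_mul_eq hPZ.eq, ← mul_assoc, hP]
    rw [hτdef, hY, h1]
    exact posDef_partialTraceRight hc0 hPh (mul_suppProj hσ.isHermitian) hZ.posDef_exp
  have hnum : num = (exp (matLog ρa + matLog τ)).trace := by
    rw [← starProd_of_posDef ha hτ]
  have hmid : (exp H * (P * exp Z)).trace = (ρa * τ).trace := by
    rw [hexpH, ← hY, trace_mul_partialTraceRight]
  have hden_le : den.re ≤ (ρa * τ).trace.re := by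
    rw [hden, ← hmid]
    exact re_trace_exp_compression_le hP hPh hH hZ hPH hPZ
  have hle_den : (ρa * τ).trace.re ≤ spechtRatio (condNumber ρa) * den.re := by
    rw [hden, ← hmid, hκ]
    exact re_trace_exp_mul_exp_compression_le hP hPh hH hZ hPH hPZ hm hmM
      (exp_bounds_of_mem_spectrum_matLog hX fun x hx => hspec x (spectrum_embedLeft_subset ρa hx))
  have hnum_le : num.re ≤ (ρa * τ).trace.re := by
    have h := re_trace_exp_add_le (isHermitian_matLog ρa) (isHermitian_matLog τ)
    rwa [exp_matLog ha, exp_matLog hτ, ← hnum] at h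
  have hle_num : (ρa * τ).trace.re ≤ spechtRatio (condNumber ρa) * num.re := by
    have h := re_trace_exp_mul_exp_le (isHermitian_matLog ρa) (isHermitian_matLog τ) hm hmM
      (exp_bounds_of_mem_spectrum_matLog ha hspec)
    rwa [exp_matLog ha, exp_matLog hτ, ← hnum, ← hκ] at h
  have hnumH := ((isHermitian_matLog ρa).add (isHermitian_matLog τ)).posDef_exp
  have hnum_real : num = (num.re : ℂ) := by
    rw [hnum]; exact hnumH.isHermitian.trace_eq_ofReal_re
  have hnum_pos : 0 < num.re := by
    rw [hnum]; exact (Complex.pos_iff.mp hnumH.trace_pos).1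
  -- Positivity of the denominator follows from `0 < num ≤ tr(ρa τ) ≤ S · den`.
  have hden_pos : 0 < den.re :=
    pos_of_mul_pos_right (hnum_pos.trans_le (hnum_le.trans hle_den)) hS.le
  have hden_real : den = (den.re : ℂ) := by
    have hPHPZ : (P * H * P + Z).IsHermitian := by
      have := isHermitian_conjTranspose_mul_mul P hH
      rw [hPh.eq] at this
      exact this.add hZ
    have hcomm : P * exp (P * H * P + Z) = exp (P * H * P + Z) * P :=
      mul_exp_of_mul_eq (by
        rw [mul_add, add_mul, hPZ.eq, mul_assoc (P * H), hP, ← mul_assoc, ← mul_assoc, hP])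
    rw [hden]
    refine IsHermitian.trace_eq_ofReal_re ?_
    rw [IsHermitian, conjTranspose_mul, hPh.eq, hPHPZ.posDef_exp.isHermitian.eq, hcomm]
  have hdiv : num / den = ((num.re / den.re : ℝ) : ℂ) := by
    rw [Complex.ofReal_div, ← hnum_real, ← hden_real]
  refine ⟨hκ1, ?_, ?_, ?_⟩
  · rw [hden_real]
    exact_mod_cast hden_pos
  · rw [hdiv, Complex.real_le_real, inv_le_iff_one_le_mul₀' hS, ← mul_div_assoc,
      one_le_div hden_pos]
    exact hden_le.trans hle_num
  · rw [hdiv, Complex.real_le_real, div_le_iff₀ hden_pos]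
    exact hnum_le.trans hle_den
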